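/- **Proposition (the theory $\mathcal T$ has the cut elimination property).** Let $\mathcal T$ be the theory in intuitionistic deduction modulo over the one-sorted language with a constant $nat$, a binary function symbol $\rightarrow$ and a unary predicate symbol $\varepsilon$, with no axioms, and with the congruence $\equiv$ on propositions generated by the two rewrite rules $$\varepsilon(nat) \longrightarrow \forall p~(\varepsilon(p) \Rightarrow (\varepsilon(nat) \Rightarrow \varepsilon(p) \Rightarrow \varepsilon(p)) \Rightarrow \varepsilon(p)),$$ $$\varepsilon(y \rightarrow z) \longrightarrow \varepsilon(y) \Rightarrow \varepsilon(z).$$ Here deduction modulo $\equiv$ is natural deduction for $\Rightarrow,\wedge,\vee,\top,\bot,\forall,\exists$ in which propositions are compared up to $\equiv$ in every rule. Proofs are written as untyped proof-terms, and reduction of proof-terms is the contextual closure of the usual rules that reduce a cut, that is, an elimination applied to the result of the corresponding introduction. Then every proof in $\mathcal T$ is strongly normalizable: for every finite list $\Gamma$ of propositions, every proposition $A$ and every proof-term $\pi$ that is a proof of $\Gamma \vdash_\equiv A$, there is no infinite reduction sequence starting from $\pi$. Moreover $\pi$ reduces to a cut-free proof (an irreducible proof-term) of the same sequent $\Gamma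 \vdash_\equiv A$. In particular every provable sequent has a cut-free proof. -/

import Mathlib

namespace DeductionModulo

/-! Binders are represented by de Bruijn indices. Term variables and proof variables are two
separate families of variables, each with its own indices. -/

/-- Terms of the one-sorted language: variables, the constant `nat` and the binary function
symbol `→`. -/
inductive Tm : Type
  | var (n : ℕ) : Tm
  | nat : Tm
  | arrow (y z : Tm) : Tm

/-- Simultaneous substitution of terms for the variables of a term. -/
def Tm.subst (σ : ℕ → Tm) : Tm → Tm
  | .var n => σ n
  | .nat => .nat
  | .arrow y z => .arrow (y.subst σ) (z.subst σ)

/-- The substitution that renames every term variable `n` to `n + 1`. -/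
def tshift : ℕ → Tm := fun n => .var (n + 1)

/-- Transport of a substitution under a binder of a term variable. -/
def tlift (σ : ℕ → Tm) : ℕ → Tm
  | 0 => .var 0
  | n + 1 => (σ n).subst tshift

/-- The substitution `t / 0` that also lowers the remaining term variables. -/
def tinst (t : Tm) : ℕ → Tm
  | 0 => t
  | n + 1 => .var n

/-- Propositions: the atomic ones are `ε(t)`; `all` and `ex` bind one term variable. -/
inductive Prp : Type
  | eps (t : Tm) : Prp
  | imp (A B : Prp) : Prp
  | and (A B : Prp) : Prp
  | or (A B : Prp) : Prp
  | top : Prp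
  | bot : Prp
  | all (A : Prp) : Prp
  | ex (A : Prp) : Prp

/-- Simultaneous capture-avoiding substitution of terms in a proposition. -/
def Prp.subst (σ : ℕ → Tm) : Prp → Prp
  | .eps t => .eps (t.subst σ)
  | .imp A B => .imp (A.subst σ) (B.subst σ)
  | .and A B => .and (A.subst σ) (B.subst σ)
  | .or A B => .or (A.subst σ) (B.subst σ)
  | .top => .top
  | .bot => .bot
  | .all A => .all (A.subst (tlift σ))
  | .ex A => .ex (A.subst (tlift σ))

/-- The same proposition in a scope with one more (fresh) term variable. -/
def Prp.shift (A : Prp) : Prp := A.subst tshift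

/-- `(t / x) A`, where `x` is the variable of index `0`. -/
def Prp.inst (A : Prp) (t : Tm) : Prp := A.subst (tinst t)

/-- Proof-terms. `lam` binds a proof variable, `case` binds a proof variable in each of its last
two arguments, `tlam` binds a term variable, and `unpack` binds in its last argument one term
variable and one proof variable. -/
inductive Pf : Type
  | var (n : ℕ) : Pf
  | lam (π : Pf) : Pf
  | app (π π' : Pf) : Pf
  | pair (π π' : Pf) : Pf
  | fst (π : Pf) : Pf
  | snd (π : Pf) : Pf
  | inl (π : Pf) : Pf
  | inr (π : Pf) : Pf
  | case (π₁ π₂ π₃ : Pf) : Pf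
  | unit : Pf
  | abort (π : Pf) : Pf
  | tlam (π : Pf) : Pf
  | tapp (π : Pf) (t : Tm) : Pf
  | tpair (t : Tm) (π : Pf) : Pf
  | unpack (π π' : Pf) : Pf

/-- Substitution of terms for the term variables of a proof-term. -/
def Pf.tsubst (σ : ℕ → Tm) : Pf → Pf
  | .var n => .var n
  | .lam π => .lam (π.tsubst σ)
  | .app π π' => .app (π.tsubst σ) (π'.tsubst σ)
  | .pair π π' => .pair (π.tsubst σ) (π'.tsubst σ)
  | .fst π => .fst (π.tsubst σ)
  | .snd π => .snd (π.tsubst σ)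
  | .inl π => .inl (π.tsubst σ)
  | .inr π => .inr (π.tsubst σ)
  | .case π₁ π₂ π₃ => .case (π₁.tsubst σ) (π₂.tsubst σ) (π₃.tsubst σ)
  | .unit => .unit
  | .abort π => .abort (π.tsubst σ)
  | .tlam π => .tlam (π.tsubst (tlift σ))
  | .tapp π t => .tapp (π.tsubst σ) (t.subst σ)
  | .tpair t π => .tpair (t.subst σ) (π.tsubst σ)
  | .unpack π π' => .unpack (π.tsubst σ) (π'.tsubst (tlift σ))

/-- Transport of a renaming under a binder of a proof variable. -/
def rlift (ρ : ℕ → ℕ) : ℕ → ℕ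
  | 0 => 0
  | n + 1 => ρ n + 1

/-- Renaming of the proof variables of a proof-term. -/
def Pf.rename (ρ : ℕ → ℕ) : Pf → Pf
  | .var n => .var (ρ n)
  | .lam π => .lam (π.rename (rlift ρ))
  | .app π π' => .app (π.rename ρ) (π'.rename ρ)
  | .pair π π' => .pair (π.rename ρ) (π'.rename ρ)
  | .fst π => .fst (π.rename ρ)
  | .snd π => .snd (π.rename ρ)
  | .inl π => .inl (π.rename ρ)
  | .inr π => .inr (π.rename ρ)
  | .case π₁ π₂ π₃ => .case (π₁.rename ρ) (π₂.rename (rlift ρ)) (π₃.rename (rlift ρ))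
  | .unit => .unit
  | .abort π => .abort (π.rename ρ)
  | .tlam π => .tlam (π.rename ρ)
  | .tapp π t => .tapp (π.rename ρ) t
  | .tpair t π => .tpair t (π.rename ρ)
  | .unpack π π' => .unpack (π.rename ρ) (π'.rename (rlift ρ))

/-- Transport of a proof substitution under a binder of a proof variable. -/
def plift (τ : ℕ → Pf) : ℕ → Pf
  | 0 => .var 0
  | n + 1 => (τ n).rename Nat.succ

/-- Transport of a proof substitution under a binder of a term variable. -/
def ptlift (τ : ℕ → Pf) : ℕ → Pf := fun n => (τ n).tsubst tshift

/-- Simultaneous capture-avoiding substitution of proof-terms for the proof variables. -/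
def Pf.subst (τ : ℕ → Pf) : Pf → Pf
  | .var n => τ n
  | .lam π => .lam (π.subst (plift τ))
  | .app π π' => .app (π.subst τ) (π'.subst τ)
  | .pair π π' => .pair (π.subst τ) (π'.subst τ)
  | .fst π => .fst (π.subst τ)
  | .snd π => .snd (π.subst τ)
  | .inl π => .inl (π.subst τ)
  | .inr π => .inr (π.subst τ)
  | .case π₁ π₂ π₃ => .case (π₁.subst τ) (π₂.subst (plift τ)) (π₃.subst (plift τ))
  | .unit => .unit
  | .abort π => .abort (π.subst τ)
  | .tlam π => .tlam (π.subst (ptlift τ))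
  | .tapp π t => .tapp (π.subst τ) t
  | .tpair t π => .tpair t (π.subst τ)
  | .unpack π π' => .unpack (π.subst τ) (π'.subst (plift (ptlift τ)))

/-- The proof substitution `π / 0` that also lowers the remaining proof variables. -/
def pinst (π : Pf) : ℕ → Pf
  | 0 => π
  | n + 1 => .var n

/-- `(π' / α) π`, where `α` is the proof variable of index `0`. -/
def Pf.inst (π π' : Pf) : Pf := π.subst (pinst π')

/-- `(t / x) π`, where `x` is the term variable of index `0`. -/
def Pf.instT (π : Pf) (t : Tm) : Pf := π.tsubst (tinst t)

/-- One-step reduction of proof-terms: the contextual closure of the cut elimination rules. -/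
inductive Red : Pf → Pf → Prop
  | beta (π₁ π₂ : Pf) : Red (.app (.lam π₁) π₂) (π₁.inst π₂)
  | tbeta (π : Pf) (t : Tm) : Red (.tapp (.tlam π) t) (π.instT t)
  | fst_pair (π₁ π₂ : Pf) : Red (.fst (.pair π₁ π₂)) π₁
  | snd_pair (π₁ π₂ : Pf) : Red (.snd (.pair π₁ π₂)) π₂
  | case_inl (π₁ π₂ π₃ : Pf) : Red (.case (.inl π₁) π₂ π₃) (π₂.inst π₁)
  | case_inr (π₁ π₂ π₃ : Pf) : Red (.case (.inr π₁) π₂ π₃) (π₃.inst π₁)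
  | unpack_tpair (t : Tm) (π₁ π₂ : Pf) :
      Red (.unpack (.tpair t π₁) π₂) ((π₂.instT t).inst π₁)
  | lam {π σ : Pf} : Red π σ → Red (.lam π) (.lam σ)
  | app_left {π σ : Pf} (ρ : Pf) : Red π σ → Red (.app π ρ) (.app σ ρ)
  | app_right {π σ : Pf} (ρ : Pf) : Red π σ → Red (.app ρ π) (.app ρ σ)
  | pair_left {π σ : Pf} (ρ : Pf) : Red π σ → Red (.pair π ρ) (.pair σ ρ)
  | pair_right {π σ : Pf} (ρ : Pf) : Red π σ → Red (.pair ρ π) (.pair ρ σ)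
  | fst {π σ : Pf} : Red π σ → Red (.fst π) (.fst σ)
  | snd {π σ : Pf} : Red π σ → Red (.snd π) (.snd σ)
  | inl {π σ : Pf} : Red π σ → Red (.inl π) (.inl σ)
  | inr {π σ : Pf} : Red π σ → Red (.inr π) (.inr σ)
  | case_scrut {π σ : Pf} (ρ₁ ρ₂ : Pf) : Red π σ → Red (.case π ρ₁ ρ₂) (.case σ ρ₁ ρ₂)
  | case_left {π σ : Pf} (ρ₁ ρ₂ : Pf) : Red π σ → Red (.case ρ₁ π ρ₂) (.case ρ₁ σ ρ₂)
  | case_right {π σ : Pf} (ρ₁ ρ₂ : Pf) : Red π σ → Red (.case ρ₁ ρ₂ π) (.case ρ₁ ρ₂ σ)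
  | abort {π σ : Pf} : Red π σ → Red (.abort π) (.abort σ)
  | tlam {π σ : Pf} : Red π σ → Red (.tlam π) (.tlam σ)
  | tapp {π σ : Pf} (t : Tm) : Red π σ → Red (.tapp π t) (.tapp σ t)
  | tpair {π σ : Pf} (t : Tm) : Red π σ → Red (.tpair t π) (.tpair t σ)
  | unpack_scrut {π σ : Pf} (ρ : Pf) : Red π σ → Red (.unpack π ρ) (.unpack σ ρ)
  | unpack_body {π σ : Pf} (ρ : Pf) : Red π σ → Red (.unpack ρ π) (.unpack ρ σ)

/-- Strongly normalizable proof-terms: all reduction sequences starting from them are finite. -/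
def SN (π : Pf) : Prop := Acc (fun σ ρ => Red ρ σ) π

/-- Cut-free (normal) proof-terms: no cut can be reduced. -/
def CutFree (π : Pf) : Prop := ∀ σ, ¬ Red π σ

/-- Intuitionistic natural deduction modulo the relation `E` on propositions:
`Proves E Γ π A` says that `π` is a proof of the sequent `Γ ⊢ A`. The proof variable of index `n`
stands for the `n`-th proposition of `Γ`. Shifting the context (and, for the elimination of `∃`,
the conclusion) expresses that the bound term variable does not occur free there. -/
inductive Proves (E : Prp → Prp → Prop) : List Prp → Pf → Prp → Prop
  | ax {Γ : List Prp} {n : ℕ} {A B : Prp} :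
      Γ[n]? = some A → E A B → Proves E Γ (.var n) B
  | imp_intro {Γ : List Prp} {π : Pf} {A B C : Prp} :
      Proves E (A :: Γ) π B → E C (.imp A B) → Proves E Γ (.lam π) C
  | imp_elim {Γ : List Prp} {π π' : Pf} {A B C : Prp} :
      Proves E Γ π C → Proves E Γ π' A → E C (.imp A B) → Proves E Γ (.app π π') B
  | and_intro {Γ : List Prp} {π π' : Pf} {A B C : Prp} :
      Proves E Γ π A → Proves E Γ π' B → E C (.and A B) → Proves E Γ (.pair π π') C
  | and_elim_left {Γ : List Prp} {π : Pf} {A B C : Prp} :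
      Proves E Γ π C → E C (.and A B) → Proves E Γ (.fst π) A
  | and_elim_right {Γ : List Prp} {π : Pf} {A B C : Prp} :
      Proves E Γ π C → E C (.and A B) → Proves E Γ (.snd π) B
  | or_intro_left {Γ : List Prp} {π : Pf} {A B C : Prp} :
      Proves E Γ π A → E C (.or A B) → Proves E Γ (.inl π) C
  | or_intro_right {Γ : List Prp} {π : Pf} {A B C : Prp} :
      Proves E Γ π B → E C (.or A B) → Proves E Γ (.inr π) C
  | or_elim {Γ : List Prp} {π₁ π₂ π₃ : Pf} {A B C D : Prp} :
      Proves E Γ π₁ D → Proves E (A :: Γ) π₂ C → Proves E (B :: Γ) π₃ C → E D (.or A B) →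
      Proves E Γ (.case π₁ π₂ π₃) C
  | top_intro {Γ : List Prp} {A : Prp} :
      E A .top → Proves E Γ .unit A
  | bot_elim {Γ : List Prp} {π : Pf} {A B : Prp} :
      Proves E Γ π B → E B .bot → Proves E Γ (.abort π) A
  | all_intro {Γ : List Prp} {π : Pf} {A B : Prp} :
      Proves E (Γ.map Prp.shift) π A → E B (.all A) → Proves E Γ (.tlam π) B
  | all_elim {Γ : List Prp} {π : Pf} {A B C : Prp} (t : Tm) :
      Proves E Γ π B → E B (.all A) → E C (A.inst t) → Proves E Γ (.tapp π t) C
  | ex_intro {Γ : List Prp} {π : Pf} {A B C : Prp} (t : Tm) :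
      Proves E Γ π C → E B (.ex A) → E C (A.inst t) → Proves E Γ (.tpair t π) B
  | ex_elim {Γ : List Prp} {π π' : Pf} {A B C : Prp} :
      Proves E Γ π C → Proves E (A :: Γ.map Prp.shift) π' B.shift → E C (.ex A) →
      Proves E Γ (.unpack π π') B

/-- The cut elimination property of deduction modulo `E`: every proof of a sequent strongly
normalizes, and it reduces to a cut-free proof of the same sequent. -/
def HasCutElimination (E : Prp → Prp → Prop) : Prop :=
  ∀ (Γ : List Prp) (π : Pf) (A : Prp), Proves E Γ π A →
    SN π ∧ ∃ π', Relation.ReflTransGen Red π π' ∧ CutFree π' ∧ Proves E Γ π' A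

/-- The instances of the two rewrite rules of the theory `𝒯`:
`ε(nat) ⟶ ∀ p, (ε(p) ⇒ (ε(nat) ⇒ ε(p) ⇒ ε(p)) ⇒ ε(p))` and
`ε(y → z) ⟶ ε(y) ⇒ ε(z)`. -/
inductive RuleT : Prp → Prp → Prop
  | nat : RuleT (.eps .nat)
      (.all (.imp (.eps (.var 0))
        (.imp (.imp (.eps .nat) (.imp (.eps (.var 0)) (.eps (.var 0))))
          (.eps (.var 0)))))
  | arrow (y z : Tm) : RuleT (.eps (.arrow y z)) (.imp (.eps y) (.eps z))

/-- One-step rewriting of propositions: a rule is applied to one atomic subproposition. -/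
inductive StepT : Prp → Prp → Prop
  | rule {A B : Prp} : RuleT A B → StepT A B
  | imp_left {A A' : Prp} (B : Prp) : StepT A A' → StepT (.imp A B) (.imp A' B)
  | imp_right {A A' : Prp} (B : Prp) : StepT A A' → StepT (.imp B A) (.imp B A')
  | and_left {A A' : Prp} (B : Prp) : StepT A A' → StepT (.and A B) (.and A' B)
  | and_right {A A' : Prp} (B : Prp) : StepT A A' → StepT (.and B A) (.and B A')
  | or_left {A A' : Prp} (B : Prp) : StepT A A' → StepT (.or A B) (.or A' B)
  | or_right {A A' : Prp} (B : Prp) : StepT A A' → StepT (.or B A) (.or B A')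
  | all {A A' : Prp} : StepT A A' → StepT (.all A) (.all A')
  | ex {A A' : Prp} : StepT A A' → StepT (.ex A) (.ex A')

/-- The congruence of the theory `𝒯`, generated by its rewrite rules. -/
def EquivT : Prp → Prp → Prop := Relation.EqvGen StepT

end DeductionModulo

namespace DeductionModulo

/-! ### Substitution in terms and propositions -/

/-! Strong normalization comes from a pre-model valued in reducibility candidates. The domain of the
sort is the set of candidates itself: `ε` is the identity, the symbol `→` is implication of
candidates, and `nat` is a fixed point of the operator read off its rewrite rule. That operator is
monotone, because `ε(nat)` occurs on the right-hand side only to the left of two implications, so a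
least fixed point exists (`natOp_natCand`). Both rules then become equalities of candidates, so
congruent propositions have the same interpretation, and adequacy (`Proves.mem_interp`) puts every
proof in the candidate of its conclusion.

That the normal form proves the same sequent is subject reduction (`Proves.red`). At a cut, the
introduction and the elimination split two merely congruent propositions, so the connectives must be
injective modulo the congruence. This follows from confluence, since rewriting acts on atoms and
never changes a head connective. -/

theorem Tm.subst_subst (t : Tm) (σ σ' : ℕ → Tm) :
    (t.subst σ).subst σ' = t.subst (fun n => (σ n).subst σ') := by
  induction t <;> simp_all [Tm.subst]

theorem Tm.subst_var (t : Tm) : t.subst Tm.var = t := by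
  induction t <;> simp_all [Tm.subst]

theorem tlift_var : tlift Tm.var = Tm.var := by
  funext n; cases n <;> rfl

theorem tlift_comp (σ σ' : ℕ → Tm) :
    (fun n => (tlift σ n).subst (tlift σ')) = tlift (fun n => (σ n).subst σ') := by
  funext n
  cases n with
  | zero => rfl
  | succ n => simp only [tlift, Tm.subst_subst]; rfl

/-- The `Nat.casesOn` form is `t` placed in front of `σ`. Bringing both orders of instantiation and
substitution to this form is what makes them comparable. -/
theorem tinst_tlift (σ : ℕ → Tm) (t : Tm) :
    (fun n => (tlift σ n).subst (tinst t)) = fun n => Nat.casesOn n t σ := by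
  funext n
  cases n with
  | zero => rfl
  | succ n => simp only [tlift, Tm.subst_subst]; exact Tm.subst_var _

theorem tinst_comp (σ : ℕ → Tm) (t : Tm) :
    (fun n => (tinst t n).subst σ) = fun n => Nat.casesOn n (t.subst σ) σ := by
  funext n; cases n <;> rfl

theorem Prp.subst_subst (A : Prp) (σ σ' : ℕ → Tm) :
    (A.subst σ).subst σ' = A.subst (fun n => (σ n).subst σ') := by
  induction A generalizing σ σ' <;> simp_all [Prp.subst, Tm.subst_subst, tlift_comp]

theorem Prp.subst_var (A : Prp) : A.subst Tm.var = A := by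
  induction A <;> simp_all [Prp.subst, Tm.subst_var, tlift_var]

theorem Prp.inst_subst (A : Prp) (t : Tm) (σ : ℕ → Tm) :
    (A.inst t).subst σ = (A.subst (tlift σ)).inst (t.subst σ) := by
  simp only [Prp.inst, Prp.subst_subst, tinst_tlift, tinst_comp]

theorem Prp.shift_subst (A : Prp) (σ : ℕ → Tm) :
    A.shift.subst (tlift σ) = (A.subst σ).shift := by
  simp only [Prp.shift, Prp.subst_subst]; rfl

theorem Prp.shift_inst (A : Prp) (t : Tm) : A.shift.subst (tinst t) = A := by
  simp only [Prp.shift, Prp.subst_subst]; exact A.subst_var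

/-! ### Substitution in proof-terms -/

theorem Pf.tsubst_tsubst (π : Pf) (σ σ' : ℕ → Tm) :
    (π.tsubst σ).tsubst σ' = π.tsubst (fun n => (σ n).subst σ') := by
  induction π generalizing σ σ' <;> simp_all [Pf.tsubst, Tm.subst_subst, tlift_comp]

theorem Pf.tsubst_var (π : Pf) : π.tsubst Tm.var = π := by
  induction π <;> simp_all [Pf.tsubst, Tm.subst_var, tlift_var]

theorem Pf.rename_tsubst (π : Pf) (ρ : ℕ → ℕ) (σ : ℕ → Tm) :
    (π.rename ρ).tsubst σ = (π.tsubst σ).rename ρ := by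
  induction π generalizing ρ σ <;> simp_all [Pf.tsubst, Pf.rename]

theorem rlift_comp (ρ ρ' : ℕ → ℕ) : (rlift ρ' ∘ rlift ρ) = rlift (ρ' ∘ ρ) := by
  funext n; cases n <;> rfl

/-- `plift` is defined by renaming, so composition of substitutions is reached in layers: two
renamings, a renaming before or after a substitution, and finally two substitutions. -/
theorem Pf.rename_rename (π : Pf) (ρ ρ' : ℕ → ℕ) :
    (π.rename ρ).rename ρ' = π.rename (ρ' ∘ ρ) := by
  induction π generalizing ρ ρ' <;> simp_all [Pf.rename, rlift_comp]

theorem plift_rlift (ρ : ℕ → ℕ) (τ : ℕ → Pf) : (plift τ ∘ rlift ρ) = plift (τ ∘ ρ) := by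
  funext n; cases n <;> rfl

theorem ptlift_comp_rename (ρ : ℕ → ℕ) (τ : ℕ → Pf) : (ptlift τ ∘ ρ) = ptlift (τ ∘ ρ) := rfl

theorem Pf.rename_subst (π : Pf) (ρ : ℕ → ℕ) (τ : ℕ → Pf) :
    (π.rename ρ).subst τ = π.subst (τ ∘ ρ) := by
  induction π generalizing ρ τ <;>
    simp_all [Pf.rename, Pf.subst, plift_rlift, ptlift_comp_rename]

theorem plift_rename (ρ : ℕ → ℕ) (τ : ℕ → Pf) :
    (fun n => (plift τ n).rename (rlift ρ)) = plift (fun n => (τ n).rename ρ) := by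
  funext n
  cases n with
  | zero => rfl
  | succ n => simp only [plift, Pf.rename_rename]; rfl

theorem ptlift_rename (ρ : ℕ → ℕ) (τ : ℕ → Pf) :
    (fun n => (ptlift τ n).rename ρ) = ptlift (fun n => (τ n).rename ρ) := by
  funext n; simp only [ptlift, Pf.rename_tsubst]

theorem Pf.subst_rename (π : Pf) (τ : ℕ → Pf) (ρ : ℕ → ℕ) :
    (π.subst τ).rename ρ = π.subst (fun n => (τ n).rename ρ) := by
  induction π generalizing ρ τ <;>
    simp_all [Pf.rename, Pf.subst, plift_rename, ptlift_rename]

theorem plift_tsubst (σ : ℕ → Tm) (τ : ℕ → Pf) :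
    (fun n => (plift τ n).tsubst σ) = plift (fun n => (τ n).tsubst σ) := by
  funext n
  cases n with
  | zero => rfl
  | succ n => simp only [plift, Pf.rename_tsubst]

theorem ptlift_tsubst (σ : ℕ → Tm) (τ : ℕ → Pf) :
    (fun n => (ptlift τ n).tsubst (tlift σ)) = ptlift (fun n => (τ n).tsubst σ) := by
  funext n; simp only [ptlift, Pf.tsubst_tsubst]; rfl

theorem Pf.subst_tsubst (π : Pf) (τ : ℕ → Pf) (σ : ℕ → Tm) :
    (π.subst τ).tsubst σ = (π.tsubst σ).subst (fun n => (τ n).tsubst σ) := by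
  induction π generalizing τ σ <;>
    simp_all [Pf.tsubst, Pf.subst, plift_tsubst, ptlift_tsubst]

theorem plift_comp (τ τ' : ℕ → Pf) :
    (fun n => (plift τ n).subst (plift τ')) = plift (fun n => (τ n).subst τ') := by
  funext n
  cases n with
  | zero => rfl
  | succ n => simp only [plift, Pf.rename_subst, Pf.subst_rename]; rfl

theorem ptlift_comp (τ τ' : ℕ → Pf) :
    (fun n => (ptlift τ n).subst (ptlift τ')) = ptlift (fun n => (τ n).subst τ') := by
  funext n; simp only [ptlift, Pf.subst_tsubst]; rfl

theorem Pf.subst_subst (π : Pf) (τ τ' : ℕ → Pf) :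
    (π.subst τ).subst τ' = π.subst (fun n => (τ n).subst τ') := by
  induction π generalizing τ τ' <;> simp_all [Pf.subst, plift_comp, ptlift_comp]

theorem plift_var : plift Pf.var = Pf.var := by
  funext n; cases n <;> rfl

theorem ptlift_var : ptlift Pf.var = Pf.var := rfl

theorem Pf.subst_var (π : Pf) : π.subst Pf.var = π := by
  induction π <;> simp_all [Pf.subst, plift_var, ptlift_var]

/-- The two families of variables are independent, so the order of the liftings is immaterial. This
matters for `unpack`, which binds one variable of each family. -/
theorem ptlift_plift (τ : ℕ → Pf) : ptlift (plift τ) = plift (ptlift τ) := by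
  funext n
  cases n with
  | zero => rfl
  | succ n => simp only [ptlift, plift, Pf.rename_tsubst]

/-- Substituting under a binder and then instantiating it. -/
theorem Pf.subst_plift_inst (π π' : Pf) (τ : ℕ → Pf) :
    (π.subst (plift τ)).inst π' = π.subst (fun n => Nat.casesOn n π' τ) := by
  rw [Pf.inst, Pf.subst_subst]
  congr 1
  funext n
  cases n with
  | zero => rfl
  | succ n => simp only [plift, Pf.rename_subst]; exact Pf.subst_var _

theorem Pf.inst_subst (π π' : Pf) (τ : ℕ → Pf) :
    (π.inst π').subst τ = (π.subst (plift τ)).inst (π'.subst τ) := by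
  rw [Pf.subst_plift_inst, Pf.inst, Pf.subst_subst]
  congr 1
  funext n; cases n <;> rfl

theorem Pf.instT_subst (π : Pf) (t : Tm) (τ : ℕ → Pf) :
    (π.instT t).subst τ = (π.subst (ptlift τ)).instT t := by
  simp only [Pf.instT, Pf.subst_tsubst, ptlift, Pf.tsubst_tsubst]
  congr 1
  funext n; exact (Pf.tsubst_var _).symm

theorem Pf.inst_tsubst (π π' : Pf) (σ : ℕ → Tm) :
    (π.inst π').tsubst σ = (π.tsubst σ).inst (π'.tsubst σ) := by
  rw [Pf.inst, Pf.subst_tsubst, Pf.inst]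
  congr 1
  funext n; cases n <;> rfl

theorem Pf.tsubst_tlift_instT (π : Pf) (t : Tm) (σ : ℕ → Tm) :
    (π.tsubst (tlift σ)).instT t = π.tsubst (fun n => Nat.casesOn n t σ) := by
  rw [Pf.instT, Pf.tsubst_tsubst, tinst_tlift]

theorem Pf.instT_tsubst (π : Pf) (t : Tm) (σ : ℕ → Tm) :
    (π.instT t).tsubst σ = (π.tsubst (tlift σ)).instT (t.subst σ) := by
  rw [Pf.tsubst_tlift_instT, Pf.instT, Pf.tsubst_tsubst, tinst_comp]

/-! ### Reduction and strong normalization -/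

theorem Red.subst {π π' : Pf} (h : Red π π') (τ : ℕ → Pf) : Red (π.subst τ) (π'.subst τ) := by
  induction h generalizing τ with
  | beta => rw [Pf.inst_subst]; exact .beta _ _
  | tbeta => rw [Pf.instT_subst]; exact .tbeta _ _
  | case_inl => rw [Pf.inst_subst]; exact .case_inl _ _ _
  | case_inr => rw [Pf.inst_subst]; exact .case_inr _ _ _
  | unpack_tpair =>
    rw [Pf.inst_subst, Pf.instT_subst, ptlift_plift]; exact .unpack_tpair _ _ _
  | _ => constructor <;> solve_by_elim

theorem Red.tsubst {π π' : Pf} (h : Red π π') (σ : ℕ → Tm) :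
    Red (π.tsubst σ) (π'.tsubst σ) := by
  induction h generalizing σ with
  | beta => rw [Pf.inst_tsubst]; exact .beta _ _
  | tbeta => rw [Pf.instT_tsubst]; exact .tbeta _ _
  | case_inl => rw [Pf.inst_tsubst]; exact .case_inl _ _ _
  | case_inr => rw [Pf.inst_tsubst]; exact .case_inr _ _ _
  | unpack_tpair => rw [Pf.inst_tsubst, Pf.instT_tsubst]; exact .unpack_tpair _ _ _
  | _ => constructor <;> solve_by_elim

theorem Red.inst {π π' : Pf} (h : Red π π') (ρ : Pf) : Red (π.inst ρ) (π'.inst ρ) := h.subst _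

theorem Red.instT {π π' : Pf} (h : Red π π') (t : Tm) : Red (π.instT t) (π'.instT t) :=
  h.tsubst _

theorem SN.intro {π : Pf} (h : ∀ σ, Red π σ → SN σ) : SN π := Acc.intro _ h

theorem SN.red {π σ : Pf} (h : SN π) (hr : Red π σ) : SN σ := Acc.inv h hr

/-- Strong normalization is reflected by every map that preserves reduction steps. -/
theorem SN.of_map {f : Pf → Pf} (hf : ∀ π σ, Red π σ → Red (f π) (f σ)) {π : Pf}
    (h : SN (f π)) : SN π := by
  generalize hx : f π = x at h
  induction h generalizing π with
  | intro x _ ih => subst hx; exact SN.intro fun σ hr => ih _ (hf _ _ hr) rfl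

theorem SN.of_inst {π ρ : Pf} (h : SN (π.inst ρ)) : SN π :=
  SN.of_map (f := fun π => π.inst ρ) (fun _ _ hr => hr.inst ρ) h

theorem SN.of_instT {π : Pf} {t : Tm} (h : SN (π.instT t)) : SN π :=
  SN.of_map (f := fun π => π.instT t) (fun _ _ hr => hr.instT t) h

theorem SN.exists_cutFree {π : Pf} (h : SN π) :
    ∃ π', Relation.ReflTransGen Red π π' ∧ CutFree π' := by
  induction h with
  | intro π _ ih =>
    by_cases hc : CutFree π
    · exact ⟨π, .refl, hc⟩
    · simp only [CutFree, not_forall, not_not] at hc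
      obtain ⟨σ, hr⟩ := hc
      obtain ⟨π', h1, h2⟩ := ih σ hr
      exact ⟨π', .head hr h1, h2⟩

/-! ### Reducibility candidates -/

/-- Proof-terms that are not built by an introduction. -/
def Neutral : Pf → Prop
  | .lam _ | .pair _ _ | .inl _ | .inr _ | .unit | .tlam _ | .tpair _ _ => False
  | _ => True

/-- Reducibility candidates. -/
@[ext]
structure Cand where
  carrier : Set Pf
  sn : ∀ π ∈ carrier, SN π
  red : ∀ π ∈ carrier, ∀ σ, Red π σ → σ ∈ carrier
  neutral : ∀ π, Neutral π → (∀ σ, Red π σ → σ ∈ carrier) → π ∈ carrier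

instance : Membership Pf Cand := ⟨fun C π => π ∈ C.carrier⟩

namespace Cand

theorem mem_ext {C D : Cand} (h : ∀ π, π ∈ C ↔ π ∈ D) : C = D :=
  Cand.ext (Set.ext h)

/-- A variable is neutral and irreducible, so the closure condition holds vacuously. Hence no
candidate is empty and the identity substitution is always reducible. -/
theorem var_mem (C : Cand) (n : ℕ) : Pf.var n ∈ C :=
  C.neutral _ trivial (by rintro _ ⟨⟩)

theorem reds {C : Cand} {π σ : Pf} (h : π ∈ C) (hr : Relation.ReflTransGen Red π σ) : σ ∈ C := by
  induction hr with
  | refl => exact h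
  | tail _ hr ih => exact C.red _ ih _ hr

/-- The candidate of all strongly normalizable proof-terms. -/
def snCand : Cand where
  carrier := {π | SN π}
  sn _ h := h
  red _ h _ hr := h.red hr
  neutral _ _ h := SN.intro h

theorem app_mem_of_neutral {C D : Cand} {π ρ : Pf} (hn : Neutral π)
    (h : ∀ σ, Red π σ → ∀ ρ ∈ C, Pf.app σ ρ ∈ D) (hρ : ρ ∈ C) : Pf.app π ρ ∈ D := by
  have hs := C.sn ρ hρ
  induction hs with
  | intro ρ _ ih =>
    refine D.neutral _ trivial fun x hx => ?_
    cases hx with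
    | beta => exact hn.elim
    | app_left _ hr => exact h _ hr _ hρ
    | app_right _ hr => exact ih _ hr (C.red _ hρ _ hr)

/-- Membership is tested by elimination. Applying to a variable, which lies in `C`, yields strong
normalization. -/
def imp (C D : Cand) : Cand where
  carrier := {π | ∀ ρ ∈ C, Pf.app π ρ ∈ D}
  sn _ h := SN.of_map (f := fun π => Pf.app π (.var 0)) (fun _ _ hr => .app_left _ hr)
    (D.sn _ (h _ (C.var_mem 0)))
  red _ h _ hr ρ hρ := D.red _ (h ρ hρ) _ (.app_left _ hr)
  neutral _ hn h _ hρ := app_mem_of_neutral hn h hρ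

def and (C D : Cand) : Cand where
  carrier := {π | Pf.fst π ∈ C ∧ Pf.snd π ∈ D}
  sn _ h := SN.of_map (f := Pf.fst) (fun _ _ hr => .fst hr) (C.sn _ h.1)
  red _ h _ hr := ⟨C.red _ h.1 _ (.fst hr), D.red _ h.2 _ (.snd hr)⟩
  neutral _ hn h := by
    constructor
    · refine C.neutral _ trivial fun x hx => ?_
      cases hx with
      | fst_pair => exact hn.elim
      | fst hr => exact (h _ hr).1
    · refine D.neutral _ trivial fun x hx => ?_
      cases hx with
      | snd_pair => exact hn.elim
      | snd hr => exact (h _ hr).2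

/-- Membership is tested on the introductions reached by reduction. A neutral term is not one of
them, so it must take at least one step first. -/
def or (C D : Cand) : Cand where
  carrier := {π | SN π ∧ (∀ ρ, Relation.ReflTransGen Red π (.inl ρ) → ρ ∈ C) ∧
    ∀ ρ, Relation.ReflTransGen Red π (.inr ρ) → ρ ∈ D}
  sn _ h := h.1
  red _ h _ hr := ⟨h.1.red hr, fun ρ hs => h.2.1 ρ (.head hr hs), fun ρ hs => h.2.2 ρ (.head hr hs)⟩
  neutral _ hn h := by
    refine ⟨SN.intro fun σ hr => (h σ hr).1, fun ρ hs => ?_, fun ρ hs => ?_⟩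
    · rcases hs.cases_head with rfl | ⟨σ, hr, hs⟩
      · exact hn.elim
      · exact (h σ hr).2.1 ρ hs
    · rcases hs.cases_head with rfl | ⟨σ, hr, hs⟩
      · exact hn.elim
      · exact (h σ hr).2.2 ρ hs

/-- The term `t` and its value `C` vary independently: the interpretation depends only on the value,
never on the syntax of the instance. -/
def all (F : Cand → Cand) : Cand where
  carrier := {π | ∀ (t : Tm) (C : Cand), Pf.tapp π t ∈ F C}
  sn _ h := SN.of_map (f := fun π => Pf.tapp π .nat) (fun _ _ hr => .tapp _ hr)
    ((F snCand).sn _ (h _ _))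
  red _ h _ hr t C := (F C).red _ (h t C) _ (.tapp t hr)
  neutral _ hn h t C := by
    refine (F C).neutral _ trivial fun x hx => ?_
    cases hx with
    | tbeta => exact hn.elim
    | tapp _ hr => exact h _ hr t C

def ex (F : Cand → Cand) : Cand where
  carrier := {π | SN π ∧ ∀ t ρ, Relation.ReflTransGen Red π (.tpair t ρ) → ∃ C, ρ ∈ F C}
  sn _ h := h.1
  red _ h _ hr := ⟨h.1.red hr, fun t ρ hs => h.2 t ρ (.head hr hs)⟩
  neutral _ hn h := by
    refine ⟨SN.intro fun σ hr => (h σ hr).1, fun t ρ hs => ?_⟩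
    rcases hs.cases_head with rfl | ⟨σ, hr, hs⟩
    · exact hn.elim
    · exact (h σ hr).2 t ρ hs

/-! #### Introductions and eliminations -/

/-- The application is neutral, so only its one-step reducts matter. The β-reduct is the hypothesis;
the others are handled by nested induction on the strong normalization of body and argument. -/
theorem lam_mem {C D : Cand} {π : Pf} (h : ∀ ρ ∈ C, π.inst ρ ∈ D) : Pf.lam π ∈ imp C D := by
  intro ρ hρ
  have hπ : SN π := SN.of_inst (D.sn _ (h _ hρ))
  have hs : SN ρ := C.sn _ hρ
  induction hπ generalizing ρ with
  | intro π _ ih₁ =>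
    induction hs with
    | intro ρ hρs ih₂ =>
      refine D.neutral _ trivial fun x hx => ?_
      cases hx with
      | beta => exact h _ hρ
      | app_left _ hr =>
        cases hr with
        | lam hr =>
          exact ih₁ _ hr (fun ρ hρ => D.red _ (h ρ hρ) _ (hr.inst ρ)) ρ hρ (Acc.intro _ hρs)
      | app_right _ hr => exact ih₂ _ hr (C.red _ hρ _ hr)

/-- The discarded component must be strongly normalizable too, since reductions may take place
inside it before the projection fires. -/
theorem fst_pair_mem {C : Cand} {π ρ : Pf} (hπ : π ∈ C) (hs : SN ρ) :
    Pf.fst (.pair π ρ) ∈ C := by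
  have hπs := C.sn _ hπ
  induction hπs generalizing ρ with
  | intro π _ ih₁ =>
    induction hs with
    | intro ρ hρs ih₂ =>
      refine C.neutral _ trivial fun x hx => ?_
      cases hx with
      | fst_pair => exact hπ
      | fst hr =>
        cases hr with
        | pair_left _ hr => exact ih₁ _ hr (C.red _ hπ _ hr) (Acc.intro _ hρs)
        | pair_right _ hr => exact ih₂ _ hr

theorem snd_pair_mem {C : Cand} {π ρ : Pf} (hs : SN π) (hρ : ρ ∈ C) :
    Pf.snd (.pair π ρ) ∈ C := by
  have hρs := C.sn _ hρ
  induction hs generalizing ρ with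
  | intro π _ ih₁ =>
    induction hρs with
    | intro ρ hρs ih₂ =>
      refine C.neutral _ trivial fun x hx => ?_
      cases hx with
      | snd_pair => exact hρ
      | snd hr =>
        cases hr with
        | pair_left _ hr => exact ih₁ _ hr hρ (Acc.intro _ hρs)
        | pair_right _ hr => exact ih₂ _ hr (C.red _ hρ _ hr)

theorem pair_mem {C D : Cand} {π ρ : Pf} (hπ : π ∈ C) (hρ : ρ ∈ D) : Pf.pair π ρ ∈ and C D :=
  ⟨fst_pair_mem hπ (D.sn _ hρ), snd_pair_mem (C.sn _ hπ) hρ⟩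

/-- This is the converse direction to `SN.of_map`: it applies to constructors that create no cut at
the root, so that every step of `f π` happens inside `π`. -/
theorem sn_congr {f : Pf → Pf} (hf : ∀ π x, Red (f π) x → ∃ σ, Red π σ ∧ x = f σ)
    {π : Pf} (h : SN π) : SN (f π) := by
  induction h with
  | intro π _ ih =>
    refine SN.intro fun x hx => ?_
    obtain ⟨σ, hr, rfl⟩ := hf _ _ hx
    exact ih σ hr

theorem reds_congr {f : Pf → Pf} (hf : ∀ π x, Red (f π) x → ∃ σ, Red π σ ∧ x = f σ)
    {π x : Pf} (h : Relation.ReflTransGen Red (f π) x) :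
    ∃ σ, Relation.ReflTransGen Red π σ ∧ x = f σ := by
  induction h with
  | refl => exact ⟨π, .refl, rfl⟩
  | tail _ hr ih =>
    obtain ⟨σ, h1, rfl⟩ := ih
    obtain ⟨σ', h2, rfl⟩ := hf _ _ hr
    exact ⟨σ', h1.tail h2, rfl⟩

theorem red_inl (π x : Pf) (h : Red (.inl π) x) : ∃ σ, Red π σ ∧ x = .inl σ := by
  cases h with | inl hr => exact ⟨_, hr, rfl⟩

theorem red_inr (π x : Pf) (h : Red (.inr π) x) : ∃ σ, Red π σ ∧ x = .inr σ := by
  cases h with | inr hr => exact ⟨_, hr, rfl⟩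

theorem red_tpair (t : Tm) (π x : Pf) (h : Red (.tpair t π) x) :
    ∃ σ, Red π σ ∧ x = .tpair t σ := by
  cases h with | tpair _ hr => exact ⟨_, hr, rfl⟩

theorem red_abort (π x : Pf) (h : Red (.abort π) x) : ∃ σ, Red π σ ∧ x = .abort σ := by
  cases h with | abort hr => exact ⟨_, hr, rfl⟩

theorem inl_mem {C D : Cand} {π : Pf} (h : π ∈ C) : Pf.inl π ∈ or C D := by
  refine ⟨sn_congr red_inl (C.sn _ h), fun ρ hs => ?_, fun ρ hs => ?_⟩
  · obtain ⟨σ, h1, h2⟩ := reds_congr red_inl hs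
    cases h2; exact reds h h1
  · obtain ⟨σ, h1, h2⟩ := reds_congr red_inl hs
    cases h2

theorem inr_mem {C D : Cand} {π : Pf} (h : π ∈ D) : Pf.inr π ∈ or C D := by
  refine ⟨sn_congr red_inr (D.sn _ h), fun ρ hs => ?_, fun ρ hs => ?_⟩
  · obtain ⟨σ, h1, h2⟩ := reds_congr red_inr hs
    cases h2
  · obtain ⟨σ, h1, h2⟩ := reds_congr red_inr hs
    cases h2; exact reds h h1

theorem tpair_mem {F : Cand → Cand} {π : Pf} {t : Tm} {C : Cand} (h : π ∈ F C) :
    Pf.tpair t π ∈ ex F := by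
  refine ⟨sn_congr (red_tpair t) ((F C).sn _ h), fun t ρ hs => ?_⟩
  obtain ⟨σ, h1, h2⟩ := reds_congr (red_tpair _) hs
  cases h2; exact ⟨C, reds h h1⟩

theorem unit_mem : Pf.unit ∈ snCand := SN.intro (by rintro _ ⟨⟩)

/-- No cut rule concerns `abort`, so strong normalization of the argument is enough for every
candidate. This is why `⊥` may be interpreted by `snCand`. -/
theorem abort_mem {C : Cand} {π : Pf} (h : SN π) : Pf.abort π ∈ C := by
  induction h with
  | intro π _ ih =>
    refine C.neutral _ trivial fun x hx => ?_
    obtain ⟨σ, hr, rfl⟩ := red_abort _ _ hx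
    exact ih σ hr

theorem tlam_mem {F : Cand → Cand} {π : Pf} (h : ∀ t C, π.instT t ∈ F C) :
    Pf.tlam π ∈ all F := by
  intro t C
  have hπ : SN π := SN.of_instT ((F C).sn _ (h t C))
  induction hπ with
  | intro π _ ih =>
    refine (F C).neutral _ trivial fun x hx => ?_
    cases hx with
    | tbeta => exact h t C
    | tapp _ hr =>
      cases hr with
      | tlam hr => exact ih _ hr fun t C => (F C).red _ (h t C) _ (hr.instT t)

/-- Triple induction on the strong normalization of the scrutinee and of the two branches, the
latter obtained by instantiating each branch with a variable. -/
theorem case_mem {C D G : Cand} {π π₁ π₂ : Pf} (h : π ∈ or C D)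
    (h₁ : ∀ ρ ∈ C, π₁.inst ρ ∈ G) (h₂ : ∀ ρ ∈ D, π₂.inst ρ ∈ G) : Pf.case π π₁ π₂ ∈ G := by
  have hs := h.1
  have hs₁ : SN π₁ := SN.of_inst (G.sn _ (h₁ _ (C.var_mem 0)))
  have hs₂ : SN π₂ := SN.of_inst (G.sn _ (h₂ _ (D.var_mem 0)))
  induction hs generalizing π₁ π₂ with
  | intro π _ ih =>
    induction hs₁ generalizing π₂ with
    | intro π₁ hπ₁ ih₁ =>
      induction hs₂ with
      | intro π₂ hπ₂ ih₂ =>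
        refine G.neutral _ trivial fun x hx => ?_
        cases hx with
        | case_inl => exact h₁ _ (h.2.1 _ .refl)
        | case_inr => exact h₂ _ (h.2.2 _ .refl)
        | case_scrut _ _ hr =>
          exact ih _ hr ((or C D).red _ h _ hr) h₁ h₂ (Acc.intro _ hπ₁) (Acc.intro _ hπ₂)
        | case_left _ _ hr =>
          exact ih₁ _ hr (fun ρ hρ => G.red _ (h₁ ρ hρ) _ (hr.inst ρ)) h₂ (Acc.intro _ hπ₂)
        | case_right _ _ hr =>
          exact ih₂ _ hr fun ρ hρ => G.red _ (h₂ ρ hρ) _ (hr.inst ρ)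

theorem unpack_mem {F : Cand → Cand} {G : Cand} {π π₁ : Pf} (h : π ∈ ex F)
    (h₁ : ∀ t C, ∀ ρ ∈ F C, (π₁.instT t).inst ρ ∈ G) : Pf.unpack π π₁ ∈ G := by
  have hs := h.1
  have hs₁ : SN π₁ :=
    SN.of_instT (SN.of_inst (G.sn _ (h₁ .nat snCand _ ((F snCand).var_mem 0))))
  induction hs generalizing π₁ with
  | intro π _ ih =>
    induction hs₁ with
    | intro π₁ hπ₁ ih₁ =>
      refine G.neutral _ trivial fun x hx => ?_
      cases hx with
      | unpack_tpair t ρ =>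
        -- The value `C` supplied by the candidate need not be related to the term `t` of the pair,
        -- hence the independent quantification in `h₁`.
        obtain ⟨C, hC⟩ := h.2 _ _ .refl
        exact h₁ _ C _ hC
      | unpack_scrut _ hr => exact ih _ hr ((ex F).red _ h _ hr) h₁ (Acc.intro _ hπ₁)
      | unpack_body _ hr =>
        exact ih₁ _ hr fun t C ρ hρ => G.red _ (h₁ t C ρ hρ) _ ((hr.instT t).inst ρ)

/-! #### The candidate of natural numbers -/

/-- The operator of which the interpretation of `nat` is the least fixed point. -/
def natOp (N : Cand) : Cand :=
  all fun C => imp C (imp (imp N (imp C C)) C)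

/-- `N` occurs positively: enlarging it shrinks the set of admissible step functions `ξ`, which
enlarges the whole. -/
theorem natOp_mono {M N : Cand} (h : ∀ π ∈ M, π ∈ N) : ∀ π ∈ natOp M, π ∈ natOp N :=
  fun _ hπ t C ρ hρ ξ hξ => hπ t C ρ hρ ξ fun ν hν => hξ ν (h ν hν)

/-- The intersection of all candidates closed under `natOp`. -/
def natCand : Cand where
  carrier := {π | ∀ N : Cand, (∀ ρ ∈ natOp N, ρ ∈ N) → π ∈ N}
  -- `snCand` is closed under `natOp`, because the elements of any candidate are strongly
  -- normalizable; the intersection is thus over a nonempty family.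
  sn _ h := h snCand fun ρ hρ => (natOp snCand).sn ρ hρ
  red _ h _ hr N hN := N.red _ (h N hN) _ hr
  neutral _ hn h N hN := N.neutral _ hn fun σ hr => h σ hr N hN

/-- Knaster–Tarski: by monotonicity `natCand` is itself closed, then so is `natOp natCand`, and
leastness gives the reverse inclusion. -/
theorem natOp_natCand : natOp natCand = natCand := by
  have h₁ : ∀ π ∈ natOp natCand, π ∈ natCand := fun π hπ N hN =>
    hN π (natOp_mono (M := natCand) (fun _ hρ => hρ N hN) π hπ)
  exact mem_ext fun π => ⟨h₁ π, fun h => h _ (natOp_mono h₁)⟩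

end Cand

/-! ### The pre-model -/

/-- Interpretation of terms. -/
def Tm.interp (φ : ℕ → Cand) : Tm → Cand
  | .var n => φ n
  | .nat => Cand.natCand
  | .arrow y z => Cand.imp (y.interp φ) (z.interp φ)

/-- Extension of a valuation by a value for the variable of index `0`. -/
def vcons (C : Cand) (φ : ℕ → Cand) : ℕ → Cand
  | 0 => C
  | n + 1 => φ n

/-- Interpretation of propositions. -/
def Prp.interp : (ℕ → Cand) → Prp → Cand
  | φ, .eps t => t.interp φ
  | φ, .imp A B => Cand.imp (A.interp φ) (B.interp φ)
  | φ, .and A B => Cand.and (A.interp φ) (B.interp φ)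
  | φ, .or A B => Cand.or (A.interp φ) (B.interp φ)
  | _, .top => Cand.snCand
  | _, .bot => Cand.snCand
  | φ, .all A => Cand.all fun C => A.interp (vcons C φ)
  | φ, .ex A => Cand.ex fun C => A.interp (vcons C φ)

theorem Tm.interp_subst (t : Tm) (σ : ℕ → Tm) (φ : ℕ → Cand) :
    (t.subst σ).interp φ = t.interp fun n => (σ n).interp φ := by
  induction t <;> simp_all [Tm.subst, Tm.interp]

theorem interp_tlift (σ : ℕ → Tm) (φ : ℕ → Cand) (C : Cand) :
    (fun n => (tlift σ n).interp (vcons C φ)) = vcons C fun n => (σ n).interp φ := by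
  funext n
  cases n with
  | zero => rfl
  | succ n => simp only [tlift, Tm.interp_subst]; rfl

theorem Prp.interp_subst (A : Prp) (σ : ℕ → Tm) (φ : ℕ → Cand) :
    (A.subst σ).interp φ = A.interp fun n => (σ n).interp φ := by
  induction A generalizing σ φ <;>
    simp_all [Prp.subst, Prp.interp, Tm.interp_subst, interp_tlift]

theorem Prp.interp_shift (A : Prp) (φ : ℕ → Cand) (C : Cand) :
    A.shift.interp (vcons C φ) = A.interp φ := A.interp_subst _ _

theorem Prp.interp_inst (A : Prp) (t : Tm) (φ : ℕ → Cand) :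
    (A.inst t).interp φ = A.interp (vcons (t.interp φ) φ) := by
  rw [Prp.inst, Prp.interp_subst]
  congr 1
  funext n; cases n <;> rfl

/-- The first rule is the fixed point equation; the second holds by definition of the interpretation
of `→`. -/
theorem RuleT.interp_eq {A B : Prp} (h : RuleT A B) (φ : ℕ → Cand) : A.interp φ = B.interp φ := by
  cases h with
  | nat => exact Cand.natOp_natCand.symm
  | arrow => rfl

theorem StepT.interp_eq {A B : Prp} (h : StepT A B) (φ : ℕ → Cand) :
    A.interp φ = B.interp φ := by
  induction h generalizing φ with
  | rule h => exact h.interp_eq φ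
  | _ => simp_all [Prp.interp]

theorem EquivT.interp_eq {A B : Prp} (h : EquivT A B) (φ : ℕ → Cand) :
    A.interp φ = B.interp φ := by
  induction h with
  | rel _ _ h => exact h.interp_eq φ
  | refl => rfl
  | symm _ _ _ ih => exact ih.symm
  | trans _ _ _ _ _ ih₁ ih₂ => exact ih₁.trans ih₂

/-- A proof substitution that is reducible for a context. -/
def RedSubst (φ : ℕ → Cand) (Γ : List Prp) (τ : ℕ → Pf) : Prop :=
  ∀ n A, Γ[n]? = some A → τ n ∈ A.interp φ

theorem RedSubst.cons {φ : ℕ → Cand} {Γ : List Prp} {τ : ℕ → Pf} (h : RedSubst φ Γ τ) {A : Prp}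
    {π : Pf} (hπ : π ∈ A.interp φ) : RedSubst φ (A :: Γ) (fun n => Nat.casesOn n π τ) := by
  intro n B hB
  cases n with
  | zero => cases hB; exact hπ
  | succ n => exact h n B hB

theorem RedSubst.shift {φ : ℕ → Cand} {Γ : List Prp} {τ : ℕ → Pf} (h : RedSubst φ Γ τ)
    (C : Cand) : RedSubst (vcons C φ) (Γ.map Prp.shift) τ := by
  intro n B hB
  rw [List.getElem?_map, Option.map_eq_some_iff] at hB
  obtain ⟨A, hA, rfl⟩ := hB
  rw [Prp.interp_shift]
  exact h n A hA

/-- Adequacy of the pre-model. -/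
theorem Proves.mem_interp {E : Prp → Prp → Prop}
    (hE : ∀ A B, E A B → ∀ φ, A.interp φ = B.interp φ) {Γ : List Prp} {π : Pf} {A : Prp}
    (h : Proves E Γ π A) (σ : ℕ → Tm) (φ : ℕ → Cand) (τ : ℕ → Pf) (hτ : RedSubst φ Γ τ) :
    (π.tsubst σ).subst τ ∈ A.interp φ := by
  induction h generalizing σ φ τ with
  | ax hn hAB => rw [← hE _ _ hAB]; exact hτ _ _ hn
  | imp_intro _ hC ih =>
    rw [hE _ _ hC]
    refine Cand.lam_mem fun ρ hρ => ?_
    rw [Pf.subst_plift_inst]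
    exact ih σ φ _ (hτ.cons hρ)
  | imp_elim _ _ hC ih₁ ih₂ =>
    have := ih₁ σ φ τ hτ
    rw [hE _ _ hC] at this
    exact this _ (ih₂ σ φ τ hτ)
  | and_intro _ _ hC ih₁ ih₂ =>
    rw [hE _ _ hC]
    exact Cand.pair_mem (ih₁ σ φ τ hτ) (ih₂ σ φ τ hτ)
  | and_elim_left _ hC ih =>
    have := ih σ φ τ hτ
    rw [hE _ _ hC] at this
    exact this.1
  | and_elim_right _ hC ih =>
    have := ih σ φ τ hτ
    rw [hE _ _ hC] at this
    exact this.2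
  | or_intro_left _ hC ih =>
    rw [hE _ _ hC]
    exact Cand.inl_mem (ih σ φ τ hτ)
  | or_intro_right _ hC ih =>
    rw [hE _ _ hC]
    exact Cand.inr_mem (ih σ φ τ hτ)
  | or_elim _ _ _ hD ih₁ ih₂ ih₃ =>
    have := ih₁ σ φ τ hτ
    rw [hE _ _ hD] at this
    refine Cand.case_mem this (fun ρ hρ => ?_) (fun ρ hρ => ?_)
    · rw [Pf.subst_plift_inst]; exact ih₂ σ φ _ (hτ.cons hρ)
    · rw [Pf.subst_plift_inst]; exact ih₃ σ φ _ (hτ.cons hρ)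
  | top_intro hA => rw [hE _ _ hA]; exact Cand.unit_mem
  | bot_elim _ _ ih => exact Cand.abort_mem (Cand.sn _ _ (ih σ φ τ hτ))
  | all_intro _ hB ih =>
    rw [hE _ _ hB]
    refine Cand.tlam_mem fun t C => ?_
    -- The term `t` is absorbed into `σ` and the candidate `C` into `φ`; the induction hypothesis
    -- allows this because it relates `σ` and `φ` in no way.
    rw [← Pf.instT_subst, Pf.tsubst_tlift_instT]
    exact ih _ _ _ (hτ.shift C)
  | all_elim t _ hB hC ih =>
    have := ih σ φ τ hτ
    rw [hE _ _ hB] at this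
    rw [hE _ _ hC, Prp.interp_inst]
    -- The term is `t.subst σ`, the candidate is `t.interp φ`.
    exact this _ _
  | ex_intro t _ hB hC ih =>
    have := ih σ φ τ hτ
    rw [hE _ _ hC, Prp.interp_inst] at this
    rw [hE _ _ hB]
    exact Cand.tpair_mem this
  | ex_elim _ _ hC ih₁ ih₂ =>
    have := ih₁ σ φ τ hτ
    rw [hE _ _ hC] at this
    refine Cand.unpack_mem this fun t C ρ hρ => ?_
    rw [← ptlift_plift, ← Pf.instT_subst, Pf.tsubst_tlift_instT, Pf.subst_plift_inst,
      ← Prp.interp_shift _ φ C]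
    exact ih₂ _ _ _ ((hτ.shift C).cons hρ)

theorem Proves.sn {Γ : List Prp} {π : Pf} {A : Prp} (h : Proves EquivT Γ π A) : SN π := by
  have := h.mem_interp (fun _ _ h φ => EquivT.interp_eq h φ) Tm.var (fun _ => Cand.snCand) Pf.var
    (fun n A _ => Cand.var_mem _ n)
  rw [Pf.tsubst_var, Pf.subst_var] at this
  exact Cand.sn _ _ this

/-! ### Confluence of rewriting and injectivity of the connectives -/

theorem RuleT.unique {A B C : Prp} (h₁ : RuleT A B) (h₂ : RuleT A C) : B = C := by
  cases h₁ <;> cases h₂ <;> rfl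

/-- Redexes are atoms and each has a unique reduct, so distinct redexes are disjoint and neither
step copies or erases the other: one step on each side closes the diagram. -/
theorem StepT.diamond {A B C : Prp} (h₁ : StepT A B) (h₂ : StepT A C) :
    B = C ∨ ∃ D, StepT B D ∧ StepT C D := by
  induction h₁ generalizing C with
  | rule h =>
    cases h₂ with
    | rule h' => exact .inl (h.unique h')
    | _ => cases h
  | imp_left B h ih =>
    cases h₂ with
    | rule h' => cases h'
    | imp_left _ h' =>
      rcases ih h' with rfl | ⟨D, h1, h2⟩
      · exact .inl rfl
      · exact .inr ⟨_, .imp_left _ h1, .imp_left _ h2⟩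
    | imp_right _ h' => exact .inr ⟨_, .imp_right _ h', .imp_left _ h⟩
  | imp_right B h ih =>
    cases h₂ with
    | rule h' => cases h'
    | imp_right _ h' =>
      rcases ih h' with rfl | ⟨D, h1, h2⟩
      · exact .inl rfl
      · exact .inr ⟨_, .imp_right _ h1, .imp_right _ h2⟩
    | imp_left _ h' => exact .inr ⟨_, .imp_left _ h', .imp_right _ h⟩
  | and_left B h ih =>
    cases h₂ with
    | rule h' => cases h'
    | and_left _ h' =>
      rcases ih h' with rfl | ⟨D, h1, h2⟩
      · exact .inl rfl
      · exact .inr ⟨_, .and_left _ h1, .and_left _ h2⟩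
    | and_right _ h' => exact .inr ⟨_, .and_right _ h', .and_left _ h⟩
  | and_right B h ih =>
    cases h₂ with
    | rule h' => cases h'
    | and_right _ h' =>
      rcases ih h' with rfl | ⟨D, h1, h2⟩
      · exact .inl rfl
      · exact .inr ⟨_, .and_right _ h1, .and_right _ h2⟩
    | and_left _ h' => exact .inr ⟨_, .and_left _ h', .and_right _ h⟩
  | or_left B h ih =>
    cases h₂ with
    | rule h' => cases h'
    | or_left _ h' =>
      rcases ih h' with rfl | ⟨D, h1, h2⟩
      · exact .inl rfl
      · exact .inr ⟨_, .or_left _ h1, .or_left _ h2⟩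
    | or_right _ h' => exact .inr ⟨_, .or_right _ h', .or_left _ h⟩
  | or_right B h ih =>
    cases h₂ with
    | rule h' => cases h'
    | or_right _ h' =>
      rcases ih h' with rfl | ⟨D, h1, h2⟩
      · exact .inl rfl
      · exact .inr ⟨_, .or_right _ h1, .or_right _ h2⟩
    | or_left _ h' => exact .inr ⟨_, .or_left _ h', .or_right _ h⟩
  | all h ih =>
    cases h₂ with
    | rule h' => cases h'
    | all h' =>
      rcases ih h' with rfl | ⟨D, h1, h2⟩
      · exact .inl rfl
      · exact .inr ⟨_, .all h1, .all h2⟩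
  | ex h ih =>
    cases h₂ with
    | rule h' => cases h'
    | ex h' =>
      rcases ih h' with rfl | ⟨D, h1, h2⟩
      · exact .inl rfl
      · exact .inr ⟨_, .ex h1, .ex h2⟩

theorem EquivT.join {A B : Prp} (h : EquivT A B) :
    Relation.Join (Relation.ReflTransGen StepT) A B := by
  have heq : Equivalence (Relation.Join (Relation.ReflTransGen StepT)) :=
    Relation.equivalence_join_reflTransGen fun A B C h₁ h₂ => by
      rcases h₁.diamond h₂ with rfl | ⟨D, h₃, h₄⟩
      · exact ⟨B, .refl, .refl⟩
      · exact ⟨D, .single h₃, .single h₄⟩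
  induction h with
  | rel _ B h => exact ⟨B, .single h, .refl⟩
  | refl => exact heq.refl _
  | symm _ _ _ ih => exact heq.symm ih
  | trans _ _ _ _ _ ih₁ ih₂ => exact heq.trans ih₁ ih₂

theorem EquivT.refl (A : Prp) : EquivT A A := Relation.EqvGen.refl A

theorem EquivT.symm {A B : Prp} (h : EquivT A B) : EquivT B A := Relation.EqvGen.symm _ _ h

theorem EquivT.trans {A B C : Prp} (h₁ : EquivT A B) (h₂ : EquivT B C) : EquivT A C :=
  Relation.EqvGen.trans _ _ _ h₁ h₂

theorem EquivT.map {f : Prp → Prp} (hf : ∀ A B, StepT A B → StepT (f A) (f B)) {A B : Prp}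
    (h : EquivT A B) : EquivT (f A) (f B) := by
  induction h with
  | rel _ _ h => exact .rel _ _ (hf _ _ h)
  | refl => exact .refl _
  | symm _ _ _ ih => exact ih.symm
  | trans _ _ _ _ _ ih₁ ih₂ => exact ih₁.trans ih₂

/-- Injectivity of a binary connective whose reducts are obtained componentwise. -/
theorem EquivT.inj_of_step {f : Prp → Prp → Prp} (hinj : Function.Injective2 f)
    (hf : ∀ A B X, StepT (f A B) X →
      ∃ A' B', X = f A' B' ∧ EquivT A A' ∧ EquivT B B')
    {A B A' B' : Prp} (h : EquivT (f A B) (f A' B')) : EquivT A A' ∧ EquivT B B' := by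
  have hs : ∀ {A B X}, Relation.ReflTransGen StepT (f A B) X →
      ∃ A' B', X = f A' B' ∧ EquivT A A' ∧ EquivT B B' := by
    intro A B X h
    induction h with
    | refl => exact ⟨A, B, rfl, .refl _, .refl _⟩
    | tail _ h ih =>
      obtain ⟨A₁, B₁, rfl, h₁, h₂⟩ := ih
      obtain ⟨A₂, B₂, rfl, h₃, h₄⟩ := hf _ _ _ h
      exact ⟨A₂, B₂, rfl, h₁.trans h₃, h₂.trans h₄⟩
  obtain ⟨X, h₁, h₂⟩ := h.join
  obtain ⟨A₁, B₁, rfl, ha, hb⟩ := hs h₁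
  obtain ⟨A₂, B₂, he, ha', hb'⟩ := hs h₂
  obtain ⟨rfl, rfl⟩ := hinj he
  exact ⟨ha.trans ha'.symm, hb.trans hb'.symm⟩

theorem StepT.equiv {A B : Prp} (h : StepT A B) : EquivT A B := .rel _ _ h

/-- An implication is never a redex itself, so each of its steps takes place in one of the two
components. -/
theorem EquivT.imp_inj {A B A' B' : Prp} (h : EquivT (.imp A B) (.imp A' B')) :
    EquivT A A' ∧ EquivT B B' := by
  refine inj_of_step (fun _ _ _ _ h => by cases h; exact ⟨rfl, rfl⟩) (fun A B X h => ?_) h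
  cases h with
  | rule h => cases h
  | imp_left _ h => exact ⟨_, _, rfl, h.equiv, .refl _⟩
  | imp_right _ h => exact ⟨_, _, rfl, .refl _, h.equiv⟩

theorem EquivT.and_inj {A B A' B' : Prp} (h : EquivT (.and A B) (.and A' B')) :
    EquivT A A' ∧ EquivT B B' := by
  refine inj_of_step (fun _ _ _ _ h => by cases h; exact ⟨rfl, rfl⟩) (fun A B X h => ?_) h
  cases h with
  | rule h => cases h
  | and_left _ h => exact ⟨_, _, rfl, h.equiv, .refl _⟩
  | and_right _ h => exact ⟨_, _, rfl, .refl _, h.equiv⟩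

theorem EquivT.or_inj {A B A' B' : Prp} (h : EquivT (.or A B) (.or A' B')) :
    EquivT A A' ∧ EquivT B B' := by
  refine inj_of_step (fun _ _ _ _ h => by cases h; exact ⟨rfl, rfl⟩) (fun A B X h => ?_) h
  cases h with
  | rule h => cases h
  | or_left _ h => exact ⟨_, _, rfl, h.equiv, .refl _⟩
  | or_right _ h => exact ⟨_, _, rfl, .refl _, h.equiv⟩

/-- Injectivity of a quantifier whose reducts are obtained by reducing its body. -/
theorem EquivT.inj_of_step_unary {f : Prp → Prp} (hinj : Function.Injective f)
    (hf : ∀ A X, StepT (f A) X → ∃ A', X = f A' ∧ EquivT A A')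
    {A A' : Prp} (h : EquivT (f A) (f A')) : EquivT A A' := by
  have hs : ∀ {A X}, Relation.ReflTransGen StepT (f A) X → ∃ A', X = f A' ∧ EquivT A A' := by
    intro A X h
    induction h with
    | refl => exact ⟨A, rfl, .refl _⟩
    | tail _ h ih =>
      obtain ⟨A₁, rfl, h₁⟩ := ih
      obtain ⟨A₂, rfl, h₃⟩ := hf _ _ h
      exact ⟨A₂, rfl, h₁.trans h₃⟩
  obtain ⟨X, h₁, h₂⟩ := h.join
  obtain ⟨A₁, rfl, ha⟩ := hs h₁
  obtain ⟨A₂, he, ha'⟩ := hs h₂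
  cases hinj he
  exact ha.trans ha'.symm

theorem EquivT.all_inj {A A' : Prp} (h : EquivT (.all A) (.all A')) : EquivT A A' := by
  refine inj_of_step_unary (fun _ _ h => by cases h; rfl) (fun A X h => ?_) h
  cases h with
  | rule h => cases h
  | all h => exact ⟨_, rfl, h.equiv⟩

theorem EquivT.ex_inj {A A' : Prp} (h : EquivT (.ex A) (.ex A')) : EquivT A A' := by
  refine inj_of_step_unary (fun _ _ h => by cases h; rfl) (fun A X h => ?_) h
  cases h with
  | rule h => cases h
  | ex h => exact ⟨_, rfl, h.equiv⟩

/-- The right-hand side for `nat` is closed, and the rule for `→` is a schema in `y` and `z`. -/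
theorem StepT.subst {A B : Prp} (h : StepT A B) (σ : ℕ → Tm) :
    StepT (A.subst σ) (B.subst σ) := by
  induction h generalizing σ with
  | rule h =>
    cases h with
    | nat => exact .rule .nat
    | arrow y z => exact .rule (.arrow _ _)
  | imp_left _ _ ih => exact .imp_left _ (ih σ)
  | imp_right _ _ ih => exact .imp_right _ (ih σ)
  | and_left _ _ ih => exact .and_left _ (ih σ)
  | and_right _ _ ih => exact .and_right _ (ih σ)
  | or_left _ _ ih => exact .or_left _ (ih σ)
  | or_right _ _ ih => exact .or_right _ (ih σ)
  | all _ ih => exact .all (ih _)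
  | ex _ ih => exact .ex (ih _)

theorem EquivT.subst {A B : Prp} (h : EquivT A B) (σ : ℕ → Tm) :
    EquivT (A.subst σ) (B.subst σ) :=
  h.map (f := Prp.subst σ) fun _ _ h => h.subst σ

/-! ### Subject reduction -/

/-- There is no separate conversion rule. The change is absorbed by the congruence premise when
there is one on the conclusion, by the principal proposition in `imp_elim` and the projections, and
by the branches in `or_elim` and `ex_elim`. -/
theorem Proves.conv {Γ : List Prp} {π : Pf} {A B : Prp} (h : Proves EquivT Γ π A)
    (hAB : EquivT A B) : Proves EquivT Γ π B := by
  induction h generalizing B with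
  | ax hn h => exact .ax hn (h.trans hAB)
  | imp_intro h hC => exact .imp_intro h (hAB.symm.trans hC)
  | imp_elim h₁ h₂ hC =>
    exact .imp_elim h₁ h₂ (hC.trans (hAB.map fun _ _ h => .imp_right _ h))
  | and_intro h₁ h₂ hC => exact .and_intro h₁ h₂ (hAB.symm.trans hC)
  | and_elim_left h hC =>
    exact .and_elim_left h (hC.trans (hAB.map (f := fun A => .and A _) fun _ _ h => .and_left _ h))
  | and_elim_right h hC =>
    exact .and_elim_right h (hC.trans (hAB.map fun _ _ h => .and_right _ h))
  | or_intro_left h hC => exact .or_intro_left h (hAB.symm.trans hC)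
  | or_intro_right h hC => exact .or_intro_right h (hAB.symm.trans hC)
  | or_elim h₁ _ _ hD _ ih₂ ih₃ => exact .or_elim h₁ (ih₂ hAB) (ih₃ hAB) hD
  | top_intro hA => exact .top_intro (hAB.symm.trans hA)
  | bot_elim h hB => exact .bot_elim h hB
  | all_intro h hB => exact .all_intro h (hAB.symm.trans hB)
  | all_elim t h hB hC => exact .all_elim t h hB (hAB.symm.trans hC)
  | ex_intro t h hB hC => exact .ex_intro t h (hAB.symm.trans hB) hC
  | ex_elim h₁ _ hC _ ih₂ => exact .ex_elim h₁ (ih₂ (hAB.subst _)) hC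

theorem map_shift_subst (Γ : List Prp) (σ : ℕ → Tm) :
    (Γ.map Prp.shift).map (Prp.subst (tlift σ)) = (Γ.map (Prp.subst σ)).map Prp.shift := by
  simp only [List.map_map]
  exact List.map_congr_left fun A _ => A.shift_subst σ

theorem map_shift_inst (Γ : List Prp) (t : Tm) :
    (Γ.map Prp.shift).map (Prp.subst (tinst t)) = Γ := by
  rw [List.map_map]
  exact (List.map_congr_left fun A _ => A.shift_inst t).trans (List.map_id _)

theorem Proves.tsubst {Γ : List Prp} {π : Pf} {A : Prp} (h : Proves EquivT Γ π A)
    (σ : ℕ → Tm) : Proves EquivT (Γ.map (Prp.subst σ)) (π.tsubst σ) (A.subst σ) := by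
  induction h generalizing σ with
  | ax hn h => exact .ax (by rw [List.getElem?_map, hn]; rfl) (h.subst σ)
  | imp_intro _ hC ih => exact .imp_intro (ih σ) (hC.subst σ)
  | imp_elim _ _ hC ih₁ ih₂ => exact .imp_elim (ih₁ σ) (ih₂ σ) (hC.subst σ)
  | and_intro _ _ hC ih₁ ih₂ => exact .and_intro (ih₁ σ) (ih₂ σ) (hC.subst σ)
  | and_elim_left _ hC ih => exact .and_elim_left (ih σ) (hC.subst σ)
  | and_elim_right _ hC ih => exact .and_elim_right (ih σ) (hC.subst σ)
  | or_intro_left _ hC ih => exact .or_intro_left (ih σ) (hC.subst σ)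
  | or_intro_right _ hC ih => exact .or_intro_right (ih σ) (hC.subst σ)
  | or_elim _ _ _ hD ih₁ ih₂ ih₃ => exact .or_elim (ih₁ σ) (ih₂ σ) (ih₃ σ) (hD.subst σ)
  | top_intro hA => exact .top_intro (hA.subst σ)
  | bot_elim _ hB ih => exact .bot_elim (ih σ) (hB.subst σ)
  | all_intro _ hB ih =>
    have := ih (tlift σ)
    rw [map_shift_subst] at this
    exact .all_intro this (hB.subst σ)
  | all_elim t _ hB hC ih =>
    have hC := hC.subst σ
    rw [Prp.inst_subst] at hC
    exact .all_elim _ (ih σ) (hB.subst σ) hC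
  | ex_intro t _ hB hC ih =>
    have hC := hC.subst σ
    rw [Prp.inst_subst] at hC
    exact .ex_intro _ (ih σ) (hB.subst σ) hC
  | ex_elim _ _ hC ih₁ ih₂ =>
    have := ih₂ (tlift σ)
    rw [List.map_cons, map_shift_subst, Prp.shift_subst] at this
    exact .ex_elim (ih₁ σ) this (hC.subst σ)

/-- `ρ` renames the propositions of `Γ` to those of `Δ`. -/
def CtxRen (ρ : ℕ → ℕ) (Γ Δ : List Prp) : Prop :=
  ∀ n A, Γ[n]? = some A → Δ[ρ n]? = some A

theorem CtxRen.cons {ρ : ℕ → ℕ} {Γ Δ : List Prp} (h : CtxRen ρ Γ Δ) (A : Prp) :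
    CtxRen (rlift ρ) (A :: Γ) (A :: Δ) := by
  intro n B hB
  cases n with
  | zero => exact hB
  | succ n => exact h n B hB

theorem CtxRen.shift {ρ : ℕ → ℕ} {Γ Δ : List Prp} (h : CtxRen ρ Γ Δ) :
    CtxRen ρ (Γ.map Prp.shift) (Δ.map Prp.shift) := by
  intro n B hB
  rw [List.getElem?_map, Option.map_eq_some_iff] at hB
  obtain ⟨A, hA, rfl⟩ := hB
  rw [List.getElem?_map, h n A hA]
  rfl

theorem Proves.rename {E : Prp → Prp → Prop} {Γ : List Prp} {π : Pf} {A : Prp}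
    (h : Proves E Γ π A) {ρ : ℕ → ℕ} {Δ : List Prp} (hρ : CtxRen ρ Γ Δ) :
    Proves E Δ (π.rename ρ) A := by
  induction h generalizing ρ Δ with
  | ax hn h => exact .ax (hρ _ _ hn) h
  | imp_intro _ hC ih => exact .imp_intro (ih (hρ.cons _)) hC
  | imp_elim _ _ hC ih₁ ih₂ => exact .imp_elim (ih₁ hρ) (ih₂ hρ) hC
  | and_intro _ _ hC ih₁ ih₂ => exact .and_intro (ih₁ hρ) (ih₂ hρ) hC
  | and_elim_left _ hC ih => exact .and_elim_left (ih hρ) hC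
  | and_elim_right _ hC ih => exact .and_elim_right (ih hρ) hC
  | or_intro_left _ hC ih => exact .or_intro_left (ih hρ) hC
  | or_intro_right _ hC ih => exact .or_intro_right (ih hρ) hC
  | or_elim _ _ _ hD ih₁ ih₂ ih₃ =>
    exact .or_elim (ih₁ hρ) (ih₂ (hρ.cons _)) (ih₃ (hρ.cons _)) hD
  | top_intro hA => exact .top_intro hA
  | bot_elim _ hB ih => exact .bot_elim (ih hρ) hB
  | all_intro _ hB ih => exact .all_intro (ih hρ.shift) hB
  | all_elim t _ hB hC ih => exact .all_elim t (ih hρ) hB hC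
  | ex_intro t _ hB hC ih => exact .ex_intro t (ih hρ) hB hC
  | ex_elim _ _ hC ih₁ ih₂ => exact .ex_elim (ih₁ hρ) (ih₂ (hρ.shift.cons _)) hC

/-- `τ` substitutes proofs in `Δ` for the propositions of `Γ`. -/
def CtxSubst (τ : ℕ → Pf) (Γ Δ : List Prp) : Prop :=
  ∀ n A, Γ[n]? = some A → Proves EquivT Δ (τ n) A

theorem CtxSubst.cons {τ : ℕ → Pf} {Γ Δ : List Prp} (h : CtxSubst τ Γ Δ) (A : Prp) :
    CtxSubst (plift τ) (A :: Γ) (A :: Δ) := by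
  intro n B hB
  cases n with
  | zero => exact .ax hB (.refl _)
  -- Weakening: `Nat.succ` sends each index of `Δ` to that of the same proposition in `A :: Δ`.
  | succ n => exact (h n B hB).rename fun _ _ h => h

theorem CtxSubst.shift {τ : ℕ → Pf} {Γ Δ : List Prp} (h : CtxSubst τ Γ Δ) :
    CtxSubst (ptlift τ) (Γ.map Prp.shift) (Δ.map Prp.shift) := by
  intro n B hB
  rw [List.getElem?_map, Option.map_eq_some_iff] at hB
  obtain ⟨A, hA, rfl⟩ := hB
  exact (h n A hA).tsubst tshift

theorem CtxSubst.pinst {Γ : List Prp} {π : Pf} {A : Prp} (h : Proves EquivT Γ π A) :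
    CtxSubst (pinst π) (A :: Γ) Γ := by
  intro n B hB
  cases n with
  | zero => cases hB; exact h
  | succ n => exact .ax hB (.refl _)

theorem Proves.subst {Γ : List Prp} {π : Pf} {A : Prp} (h : Proves EquivT Γ π A)
    {τ : ℕ → Pf} {Δ : List Prp} (hτ : CtxSubst τ Γ Δ) : Proves EquivT Δ (π.subst τ) A := by
  induction h generalizing τ Δ with
  | ax hn h => exact (hτ _ _ hn).conv h
  | imp_intro _ hC ih => exact .imp_intro (ih (hτ.cons _)) hC
  | imp_elim _ _ hC ih₁ ih₂ => exact .imp_elim (ih₁ hτ) (ih₂ hτ) hC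
  | and_intro _ _ hC ih₁ ih₂ => exact .and_intro (ih₁ hτ) (ih₂ hτ) hC
  | and_elim_left _ hC ih => exact .and_elim_left (ih hτ) hC
  | and_elim_right _ hC ih => exact .and_elim_right (ih hτ) hC
  | or_intro_left _ hC ih => exact .or_intro_left (ih hτ) hC
  | or_intro_right _ hC ih => exact .or_intro_right (ih hτ) hC
  | or_elim _ _ _ hD ih₁ ih₂ ih₃ =>
    exact .or_elim (ih₁ hτ) (ih₂ (hτ.cons _)) (ih₃ (hτ.cons _)) hD
  | top_intro hA => exact .top_intro hA
  | bot_elim _ hB ih => exact .bot_elim (ih hτ) hB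
  | all_intro _ hB ih => exact .all_intro (ih hτ.shift) hB
  | all_elim t _ hB hC ih => exact .all_elim t (ih hτ) hB hC
  | ex_intro t _ hB hC ih => exact .ex_intro t (ih hτ) hB hC
  | ex_elim _ _ hC ih₁ ih₂ => exact .ex_elim (ih₁ hτ) (ih₂ (hτ.shift.cons _)) hC

theorem Proves.inst {Γ : List Prp} {π π' : Pf} {A B : Prp} (h : Proves EquivT (A :: Γ) π B)
    (h' : Proves EquivT Γ π' A) : Proves EquivT Γ (π.inst π') B :=
  h.subst (CtxSubst.pinst h')

/-- At a cut, injectivity identifies, up to congruence, the components named by the introduction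
with those named by the elimination, and `Proves.conv` absorbs the difference. -/
theorem Proves.red {π σ : Pf} (hr : Red π σ) {Γ : List Prp} {A : Prp}
    (h : Proves EquivT Γ π A) : Proves EquivT Γ σ A := by
  induction hr generalizing Γ A with
  | beta =>
    cases h with
    | imp_elim h₁ h₂ hC =>
      cases h₁ with
      | imp_intro h₁ hC' =>
        obtain ⟨ha, hb⟩ := (hC'.symm.trans hC).imp_inj
        -- The argument is converted backwards, to the hypothesis discharged by the abstraction; the
        -- result is converted forwards.
        exact (h₁.inst (h₂.conv ha.symm)).conv hb
  | tbeta _ t =>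
    cases h with
    | all_elim _ h₁ hB hC =>
      cases h₁ with
      | all_intro h₁ hB' =>
        have := h₁.tsubst (tinst t)
        rw [map_shift_inst] at this
        exact this.conv (((hB'.symm.trans hB).all_inj.subst _).trans hC.symm)
  | fst_pair =>
    cases h with
    | and_elim_left h hC =>
      cases h with
      | and_intro h₁ h₂ hC' => exact h₁.conv (hC'.symm.trans hC).and_inj.1
  | snd_pair =>
    cases h with
    | and_elim_right h hC =>
      cases h with
      | and_intro h₁ h₂ hC' => exact h₂.conv (hC'.symm.trans hC).and_inj.2
  | case_inl =>
    cases h with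
    | or_elim h h₁ h₂ hD =>
      cases h with
      | or_intro_left h hD' => exact h₁.inst (h.conv (hD'.symm.trans hD).or_inj.1)
  | case_inr =>
    cases h with
    | or_elim h h₁ h₂ hD =>
      cases h with
      | or_intro_right h hD' => exact h₂.inst (h.conv (hD'.symm.trans hD).or_inj.2)
  | unpack_tpair t =>
    cases h with
    | ex_elim h h₁ hC =>
      cases h with
      | ex_intro _ h hC' hA =>
        have := h₁.tsubst (tinst t)
        -- Freshness of the bound variable: instantiating it by `t` leaves the context and the
        -- conclusion unchanged.
        rw [List.map_cons, map_shift_inst, Prp.shift_inst] at this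
        exact this.inst (h.conv (hA.trans ((hC'.symm.trans hC).ex_inj.subst _)))
  | lam _ ih => cases h with | imp_intro h hC => exact .imp_intro (ih h) hC
  | app_left _ _ ih => cases h with | imp_elim h₁ h₂ hC => exact .imp_elim (ih h₁) h₂ hC
  | app_right _ _ ih => cases h with | imp_elim h₁ h₂ hC => exact .imp_elim h₁ (ih h₂) hC
  | pair_left _ _ ih => cases h with | and_intro h₁ h₂ hC => exact .and_intro (ih h₁) h₂ hC
  | pair_right _ _ ih => cases h with | and_intro h₁ h₂ hC => exact .and_intro h₁ (ih h₂) hC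
  | fst _ ih => cases h with | and_elim_left h hC => exact .and_elim_left (ih h) hC
  | snd _ ih => cases h with | and_elim_right h hC => exact .and_elim_right (ih h) hC
  | inl _ ih => cases h with | or_intro_left h hC => exact .or_intro_left (ih h) hC
  | inr _ ih => cases h with | or_intro_right h hC => exact .or_intro_right (ih h) hC
  | case_scrut _ _ _ ih =>
    cases h with | or_elim h h₁ h₂ hD => exact .or_elim (ih h) h₁ h₂ hD
  | case_left _ _ _ ih =>
    cases h with | or_elim h h₁ h₂ hD => exact .or_elim h (ih h₁) h₂ hD
  | case_right _ _ _ ih =>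
    cases h with | or_elim h h₁ h₂ hD => exact .or_elim h h₁ (ih h₂) hD
  | abort _ ih => cases h with | bot_elim h hB => exact .bot_elim (ih h) hB
  | tlam _ ih => cases h with | all_intro h hB => exact .all_intro (ih h) hB
  | tapp _ _ ih => cases h with | all_elim _ h hB hC => exact .all_elim _ (ih h) hB hC
  | tpair _ _ ih => cases h with | ex_intro _ h hB hC => exact .ex_intro _ (ih h) hB hC
  | unpack_scrut _ _ ih => cases h with | ex_elim h h₁ hC => exact .ex_elim (ih h) h₁ hC
  | unpack_body _ _ ih => cases h with | ex_elim h h₁ hC => exact .ex_elim h (ih h₁) hC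

theorem Proves.reds {Γ : List Prp} {π σ : Pf} {A : Prp} (h : Proves EquivT Γ π A)
    (hr : Relation.ReflTransGen Red π σ) : Proves EquivT Γ σ A := by
  induction hr with
  | refl => exact h
  | tail _ hr ih => exact ih.red hr

end DeductionModulo

/-- The theory `𝒯` has the cut elimination property. -/
theorem mainTheorem4 : DeductionModulo.HasCutElimination DeductionModulo.EquivT := by
  intro Γ π A h
  obtain ⟨π', hr, hc⟩ := h.sn.exists_cutFree
  exact ⟨h.sn, π', hr, hc, h.reds hr⟩
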